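/- Let $n,M\in\mathbb N$, let $\mathcal M_1,\dots,\mathcal M_M$ be pairwise disjoint Borel sets with $\bigcup_j\mathcal M_j=\mathbb R^n$, let $A_1,\dots,A_M\in\mathbb R^{n\times n}$, and consider the switched linear dynamical system (SLDS) $$x_{t+1}=\sum_{j=1}^M (A_jx_t+w_t^j)\,\chi_{\mathcal M_j}(x_t),\qquad t\ge 0,$$ where $w_t^j\sim\mathcal N(0,I_n)$, the noise vectors $(w_t^1,\dots,w_t^M)$, $t\ge0$, are independent over time, and the noise is independent of $x_0$. Let $P(x,\cdot)=\sum_j \chi_{\mathcal M_j}(x)\,\mathcal N(A_jx,I_n)$, let $\|\cdot\|$ denote the Euclidean norm on $\mathbb R^n$ and the induced matrix 2-norm, $V(x)=\|x\|$, and $\mathcal B_\varrho=\{x:\|x\|\le\varrho\}$. Assume that $\varrho,L,\gamma\in\mathbb R$ with $\gamma<1$ are such that $\|A_k\|\le L$ for every $k$ with $\mathcal M_k\subsetneq\mathcal B_\varrho$, and $\|A_j\|\le\gamma$ for every other $j$. Then: 1. Every solution $(x_t)$ of the system is a Markov chain with transition kernel $P$. 2. (Geometric drift) For all $x\in\mathbb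 R^n$, $V$ is integrable with respect to $P(x,\cdot)$ and $PV(x)\le\gamma V(x)+K$ with $K=\sqrt{n+L^2\varrho^2}$. 3. (Minorization) There are $R>\frac{2K}{1-\gamma}$, $b\in(0,1)$ and a probability measure $\hat\nu$ such that $P(x,\cdot)\ge b\,\hat\nu(\cdot)$ for all $x$ with $V(x)\le R$. 4. $P$ has exactly one invariant probability measure $\mu_\pi$, and $\mu_\pi$ is ergodic (every Borel set $B$ with $P(x,B)=\chi_B(x)$ for $\mu_\pi$-almost every $x$ has $\mu_\pi(B)\in\{0,1\}$). 5. (Geometric mixing) There are $\beta^*>0$, $\kappa\in(0,1)$ and $C\in(0,\infty)$ such that, with $d(x,y)=(2+\beta^*V(x)+\beta^*V(y))\chi_{x\ne y}$ and $\mathcal W_d(\mu,\nu)=\inf \mathbb E\,d(X,Y)$, the infimum over all couplings $(X,Y)$ of $\mu$ and $\nu$, for all $x,y\in\mathbb R^n$ and all $m\ge1$: $$\mathcal W_d(P(x,\cdot),P(y,\cdot))\le\kappa\, d(x,y),\qquad \mathcal W_d(P(x,\cdot),\mu_\pi)<\infty,\qquad \mathcal W_d(P^m(x,\cdot),\mu_\pi)\le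 C\kappa^m\,\mathcal W_d(P(x,\cdot),\mu_\pi).$$ -/

import Mathlib

open scoped MatrixOrder
open MeasureTheory ProbabilityTheory
open scoped ENNReal

/-! ### General notions for Markov kernels -/

/-- Geometric drift condition `P V ≤ γ V + K`; integrability of `V` under every `P(x, ·)` is part
of the condition, so that the integral below is a genuine expectation. -/
def GeometricDrift {X : Type*} [MeasurableSpace X] (P : Kernel X X) (V : X → ℝ) (γ K : ℝ) :
    Prop :=
  ∀ x, Integrable V (P x) ∧ ∫ y, V y ∂(P x) ≤ γ * V x + K

/-- Minorization condition `P(x, ·) ≥ β ν(·)` on the level set `{x | V x ≤ R}`, for some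
`β ∈ (0, 1)` and some probability measure `ν`. -/
def Minorization {X : Type*} [MeasurableSpace X] (P : Kernel X X) (V : X → ℝ) (R : ℝ) : Prop :=
  ∃ β : ℝ, 0 < β ∧ β < 1 ∧ ∃ ν : Measure X, IsProbabilityMeasure ν ∧
    ∀ x, V x ≤ R → ENNReal.ofReal β • ν ≤ P x

/-- The distance function `d(x, y) = (2 + β V(x) + β V(y)) 1_{x ≠ y}`. -/
noncomputable def weightedDist {X : Type*} (β : ℝ) (V : X → ℝ) (x y : X) : ℝ :=
  open Classical in if x = y then 0 else 2 + β * V x + β * V y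

/-- The Wasserstein distance of order one for the cost `d`: the infimum of `E d(X, Y)` over all
couplings of `μ` and `ν`. -/
noncomputable def wasserstein {X : Type*} [MeasurableSpace X] (d : X → X → ℝ) (μ ν : Measure X) :
    ℝ≥0∞ :=
  ⨅ (π : Measure (X × X)) (_ : π.map Prod.fst = μ ∧ π.map Prod.snd = ν),
    ∫⁻ p, ENNReal.ofReal (d p.1 p.2) ∂π

/-- `μ` is an ergodic invariant probability measure of `P`: it is invariant, and every set that is
`μ`-almost surely invariant under `P` has measure zero or one. -/
def IsErgodicInvariant {X : Type*} [MeasurableSpace X] (P : Kernel X X) (μ : Measure X) : Prop :=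
  IsProbabilityMeasure μ ∧ P.Invariant μ ∧
    ∀ B : Set X, MeasurableSet B → (∀ᵐ x ∂μ, P x B = B.indicator 1 x) → μ B = 0 ∨ μ B = 1

/-- The process `x` is a Markov chain with transition kernel `P`: the joint law of
`(x_0, …, x_t)` and `x_{t+1}` is the law of `(x_0, …, x_t)` followed by `P(x_t, ·)`. -/
def IsMarkovChain {X Ω : Type*} [MeasurableSpace X] [MeasurableSpace Ω] (P : Kernel X X)
    (Pr : Measure Ω) (x : ℕ → Ω → X) : Prop :=
  ∀ t : ℕ,
    Pr.map (fun ω => ((fun i : Fin (t + 1) => x i ω), x (t + 1) ω)) =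
      (Pr.map (fun ω (i : Fin (t + 1)) => x i ω)) ⊗ₘ
        (P.comap (fun h : Fin (t + 1) → X => h (Fin.last t)) (measurable_pi_apply _))

/-! ### Switched linear dynamical systems -/

/-- A switched linear dynamical system on `ℝⁿ` with `M` modes: a matrix for every mode and a
partition of `ℝⁿ` into `M` Borel regions. -/
structure SLDS (n M : ℕ) where
  /-- the system matrices -/
  A : Fin M → Matrix (Fin n) (Fin n) ℝ
  /-- the regions -/
  region : Fin M → Set (EuclideanSpace ℝ (Fin n))
  measurableSet_region : ∀ j, MeasurableSet (region j)
  disjoint_region : ∀ j k, j ≠ k → Disjoint (region j) (region k)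
  iUnion_region : ⋃ j, region j = Set.univ

namespace SLDS

variable {n M : ℕ}

/-- The linear map `x ↦ A_j x` on Euclidean space; its norm is the matrix 2-norm of `A_j`. -/
noncomputable def lin (S : SLDS n M) (j : Fin M) :
    EuclideanSpace ℝ (Fin n) →L[ℝ] EuclideanSpace ℝ (Fin n) :=
  Matrix.toEuclideanCLM (𝕜 := ℝ) (S.A j)

/-- The process `x` is driven by the noise `w` through
`x_{t+1} = ∑_j (A_j x_t + w_t^j) 1_{M_j}(x_t)`, where `w_t^j ∼ N(0, I_n)`, the noise is
independent over time and independent of the initial state. -/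
structure IsTrajectory (S : SLDS n M) {Ω : Type*} [MeasurableSpace Ω] (Pr : Measure Ω)
    (w : ℕ → Fin M → Ω → EuclideanSpace ℝ (Fin n)) (x : ℕ → Ω → EuclideanSpace ℝ (Fin n)) :
    Prop where
  measurable_init : Measurable (x 0)
  measurable_noise : ∀ t j, Measurable (w t j)
  law_noise : ∀ t j, Pr.map (w t j) = multivariateGaussian 0 1
  indep_time : iIndepFun (fun (t : ℕ) (ω : Ω) (j : Fin M) => w t j ω) Pr
  indep_init : IndepFun (x 0) (fun (ω : Ω) (t : ℕ) (j : Fin M) => w t j ω) Pr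
  step : ∀ t ω, x (t + 1) ω =
    ∑ j, (S.region j).indicator (fun z => S.lin j z + w t j ω) (x t ω)

/-- The transition kernel `P(x, ·) = ∑_j 1_{M_j}(x) N(A_j x, I_n)`. -/
noncomputable def transition (S : SLDS n M) :
    Kernel (EuclideanSpace ℝ (Fin n)) (EuclideanSpace ℝ (Fin n)) where
  toFun x := ∑ j, (S.region j).indicator (fun z => multivariateGaussian (S.lin j z) 1) x
  measurable' := by
    refine Measure.measurable_of_measurable_coe _ fun s hs => ?_
    simp only [Measure.coe_finsetSum, Finset.sum_apply]
    refine Finset.measurable_sum _ fun j _ => ?_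
    have key : Measurable fun z => multivariateGaussian (S.lin j z) 1 s := by
      have h : ∀ z, multivariateGaussian (S.lin j z) 1 s =
          stdGaussian (EuclideanSpace ℝ (Fin n))
            (Prod.mk z ⁻¹' ((fun p : EuclideanSpace ℝ (Fin n) × EuclideanSpace ℝ (Fin n) =>
              S.lin j p.1 + Matrix.toEuclideanCLM (𝕜 := ℝ) (CFC.sqrt (1 : Matrix (Fin n) (Fin n) ℝ)) p.2) ⁻¹' s)) := by
        intro z
        rw [multivariateGaussian, Measure.map_apply (by fun_prop) hs]
        rfl
      simp only [h]
      exact measurable_measure_prodMk_left (hs.preimage (by fun_prop))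
    have h2 : (fun x => ((S.region j).indicator
        (fun z => multivariateGaussian (S.lin j z) 1) x) s) =
        (S.region j).indicator (fun z => multivariateGaussian (S.lin j z) 1 s) := by
      ext x
      by_cases hx : x ∈ S.region j <;> simp [hx]
    rw [h2]
    exact key.indicator (S.measurableSet_region j)

end SLDS

/-!
The transition kernel `P` satisfies a drift and a minorization condition, and Harris' theorem turns
these into a unique, geometrically attracting invariant measure.

*Drift.* Under `N(m, I)` the second moment of the norm is `n + ‖m‖ ^ 2`, so the mean of the norm is
at most `√(n + ‖m‖ ^ 2)`. With `m = A_j x` this is at most `√(n + L ^ 2 * ϱ ^ 2)` on the bounded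
regions and at most `√n + γ * ‖x‖` on the others. Since the regions cover the space, they are not
all proper subsets of the ball; hence some `‖A_j‖` is at most `γ`, and `γ` is nonnegative.

*Minorization.* As `(y - m) ^ 2 / 2 ≤ y ^ 2 + m ^ 2`, the law `N(m, I)` dominates a multiple of
`N(0, I / 2)`, with a factor that is uniform for bounded `m`; so minorization holds on every ball
(`SLDS.minorization_transition`).

*Harris' theorem.* Drift and minorization give a kernel `Q` on pairs that couples `P x` with `P y`
and contracts the cost `d` by a factor `κ < 1` (`exists_isContractiveCoupling`): pairs that have met
stay together, other pairs meet with a fixed probability while `V x + V y < R`, and beyond that the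
drift suffices.
Composing with `Q` shows that `P` contracts the Wasserstein distance, with no need for a measurable
selection of optimal couplings. The iterates of `Q` couple successive laws `P ^ k x₀` and
`P ^ (k + 1) x₀` at geometrically decreasing cost, so these laws converge setwise to an invariant
measure, against which `d` is integrable (`IsContractiveCoupling.exists_invariant`). Then
`P ^ m x` converges setwise to that measure for every `x`, which forces uniqueness and ergodicity.

*Markov property.* The history up to time `t` is a measurable function of `x_0` and of the noise
before time `t`, hence independent of the noise at time `t`, and the law of one step from `z` is
`P z`.
-/

/-! ### Couplings and contraction of the Wasserstein distance -/

section Coupling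

variable {X : Type*} [MeasurableSpace X]

/-- `Q` couples the transitions of `P` from any two points `x`, `y` in such a way that the expected
cost after one step is at most `κ * d x y`. Being a kernel, `Q` depends measurably on `(x, y)`. -/
structure IsContractiveCoupling (P : Kernel X X) (d : X → X → ℝ) (κ : ℝ≥0∞)
    (Q : Kernel (X × X) (X × X)) : Prop where
  map_fst : ∀ p, (Q p).map Prod.fst = P p.1
  map_snd : ∀ p, (Q p).map Prod.snd = P p.2
  lintegral_le : ∀ p, ∫⁻ q, ENNReal.ofReal (d q.1 q.2) ∂(Q p) ≤ κ * ENNReal.ofReal (d p.1 p.2)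

lemma wasserstein_le_lintegral (d : X → X → ℝ) {μ ν : Measure X} {π : Measure (X × X)}
    (h1 : π.map Prod.fst = μ) (h2 : π.map Prod.snd = ν) :
    wasserstein d μ ν ≤ ∫⁻ p, ENNReal.ofReal (d p.1 p.2) ∂π :=
  iInf₂_le π ⟨h1, h2⟩

lemma measure_compl_diagonal_le [MeasurableEq X] {d : X → X → ℝ}
    (hd1 : ∀ x y, x ≠ y → 1 ≤ d x y) (π : Measure (X × X)) :
    π (Set.diagonal X)ᶜ ≤ ∫⁻ p, ENNReal.ofReal (d p.1 p.2) ∂π := by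
  rw [← lintegral_indicator_one measurableSet_diagonal.compl]
  refine lintegral_mono fun p => ?_
  by_cases hp : p ∈ (Set.diagonal X)ᶜ
  · simpa [hp] using hd1 p.1 p.2 hp
  · simp [hp]

/-- A cost that is at least one off the diagonal dominates the total variation distance. -/
lemma measure_le_add_wasserstein [MeasurableEq X] {d : X → X → ℝ}
    (hd1 : ∀ x y, x ≠ y → 1 ≤ d x y) (μ ν : Measure X) {s : Set X} (hs : MeasurableSet s) :
    μ s ≤ ν s + wasserstein d μ ν ∧ ν s ≤ μ s + wasserstein d μ ν := by
  simp only [wasserstein, ENNReal.add_iInf]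
  refine ⟨le_iInf₂ fun π hπ => ?_, le_iInf₂ fun π hπ => ?_⟩
  all_goals
    refine le_trans ?_ (add_le_add_right (measure_compl_diagonal_le hd1 π) _)
    rw [← hπ.1, ← hπ.2, Measure.map_apply measurable_fst hs, Measure.map_apply measurable_snd hs]
    refine (measure_mono fun p hp => ?_).trans (measure_union_le _ _)
    by_cases h : p.1 = p.2
    · left; simpa [h] using hp
    · right; exact h

namespace IsContractiveCoupling

variable {P : Kernel X X} {d : X → X → ℝ} {κ : ℝ≥0∞} {Q : Kernel (X × X) (X × X)}

lemma map_fst_comp (hQ : IsContractiveCoupling P d κ Q) (π : Measure (X × X)) :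
    (Q ∘ₘ π).map Prod.fst = P ∘ₘ (π.map Prod.fst) := by
  ext s hs
  rw [Measure.map_comp _ _ measurable_fst, Measure.bind_apply hs (by fun_prop),
    Measure.bind_apply hs (by fun_prop), lintegral_map (P.measurable_coe hs) measurable_fst]
  simp only [Kernel.map_apply _ measurable_fst, hQ.map_fst]

lemma map_snd_comp (hQ : IsContractiveCoupling P d κ Q) (π : Measure (X × X)) :
    (Q ∘ₘ π).map Prod.snd = P ∘ₘ (π.map Prod.snd) := by
  ext s hs
  rw [Measure.map_comp _ _ measurable_snd, Measure.bind_apply hs (by fun_prop),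
    Measure.bind_apply hs (by fun_prop), lintegral_map (P.measurable_coe hs) measurable_snd]
  simp only [Kernel.map_apply _ measurable_snd, hQ.map_snd]

lemma lintegral_comp_le (hQ : IsContractiveCoupling P d κ Q)
    (hd : Measurable fun p : X × X => ENNReal.ofReal (d p.1 p.2)) (π : Measure (X × X)) :
    ∫⁻ p, ENNReal.ofReal (d p.1 p.2) ∂(Q ∘ₘ π) ≤ κ * ∫⁻ p, ENNReal.ofReal (d p.1 p.2) ∂π := by
  rw [Measure.lintegral_bind (by fun_prop) hd.aemeasurable, ← lintegral_const_mul _ hd]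
  exact lintegral_mono hQ.lintegral_le

lemma wasserstein_comp_le (hQ : IsContractiveCoupling P d κ Q)
    (hd : Measurable fun p : X × X => ENNReal.ofReal (d p.1 p.2)) (hκ0 : κ ≠ 0) (hκ : κ ≠ ∞)
    (μ ν : Measure X) : wasserstein d (P ∘ₘ μ) (P ∘ₘ ν) ≤ κ * wasserstein d μ ν := by
  simp only [wasserstein, ENNReal.mul_iInf_of_ne hκ0 hκ]
  refine le_iInf₂ fun π hπ => ?_
  refine (wasserstein_le_lintegral d ?_ ?_).trans (hQ.lintegral_comp_le hd π)
  · rw [hQ.map_fst_comp, hπ.1]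
  · rw [hQ.map_snd_comp, hπ.2]

lemma wasserstein_pow_comp_le (hQ : IsContractiveCoupling P d κ Q)
    (hd : Measurable fun p : X × X => ENNReal.ofReal (d p.1 p.2)) (hκ0 : κ ≠ 0) (hκ : κ ≠ ∞)
    (μ ν : Measure X) (m : ℕ) :
    wasserstein d (⇑(P ^ m) ∘ₘ μ) (⇑(P ^ m) ∘ₘ ν) ≤ κ ^ m * wasserstein d μ ν := by
  induction m with
  | zero =>
    have h : P ^ 0 = Kernel.id := pow_zero P
    rw [h, Measure.id_comp, Measure.id_comp, pow_zero, one_mul]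
  | succ m ih =>
    have h : P ^ (m + 1) = P ∘ₖ (P ^ m) := pow_succ' P m
    rw [h, ← Measure.comp_assoc, ← Measure.comp_assoc, pow_succ', mul_assoc]
    exact (hQ.wasserstein_comp_le hd hκ0 hκ _ _).trans (by gcongr)

end IsContractiveCoupling

lemma ProbabilityTheory.Kernel.Invariant.pow {P : Kernel X X} {μ : Measure X}
    (h : P.Invariant μ) (m : ℕ) : (P ^ m).Invariant μ := by
  induction m with
  | zero => exact Measure.bind_dirac
  | succ m ih => rw [pow_succ]; exact Kernel.Invariant.comp ih h

lemma IsContractiveCoupling.wasserstein_pow_succ_le {P : Kernel X X} {d : X → X → ℝ} {κ : ℝ≥0∞}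
    {Q : Kernel (X × X) (X × X)} (hQ : IsContractiveCoupling P d κ Q)
    (hd : Measurable fun p : X × X => ENNReal.ofReal (d p.1 p.2)) (hκ0 : κ ≠ 0) (hκ : κ ≠ ∞)
    {μ : Measure X} (hμ : P.Invariant μ) (x : X) (m : ℕ) :
    wasserstein d ((P ^ (m + 1)) x) μ ≤ κ ^ m * wasserstein d (P x) μ := by
  have h := hQ.wasserstein_pow_comp_le hd hκ0 hκ (P x) μ m
  rwa [(hμ.pow m).def] at h

/-! ### Uniqueness and ergodicity of a globally attracting invariant measure -/

section Attracting

variable {P : Kernel X X} {μ : Measure X}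

/-- The powers of a Markov kernel are Markov kernels. -/
instance isMarkovKernel_pow [IsMarkovKernel P] (m : ℕ) : IsMarkovKernel (P ^ m) := by
  induction m with
  | zero => exact inferInstanceAs (IsMarkovKernel Kernel.id)
  | succ m ih => rw [pow_succ]; exact Kernel.IsMarkovKernel.comp _ _

lemma eq_of_invariant_of_tendsto [IsMarkovKernel P]
    (h : ∀ x s, MeasurableSet s → Filter.Tendsto (fun m => (P ^ m) x s) Filter.atTop (nhds (μ s)))
    {ν : Measure X} [IsProbabilityMeasure ν] (hν : P.Invariant ν) : ν = μ := by
  ext s hs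
  have h1 : Filter.Tendsto (fun m => ∫⁻ x, (P ^ m) x s ∂ν) Filter.atTop
      (nhds (∫⁻ _, μ s ∂ν)) :=
    tendsto_lintegral_of_dominated_convergence 1 (fun m => (P ^ m).measurable_coe hs)
      (fun m => Filter.Eventually.of_forall fun x => prob_le_one) (by simp)
      (Filter.Eventually.of_forall fun x => h x s hs)
  have h2 : ∀ m, ∫⁻ x, (P ^ m) x s ∂ν = ν s := fun m => by
    rw [← Measure.bind_apply hs (by fun_prop), (hν.pow m).def]
  simp only [h2, lintegral_const, measure_univ, mul_one] at h1
  exact tendsto_nhds_unique tendsto_const_nhds h1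

lemma pow_apply_eq_indicator_of_ae_eq (hμ : P.Invariant μ) {B : Set X} (hB : MeasurableSet B)
    (h : ∀ᵐ x ∂μ, P x B = B.indicator 1 x) (m : ℕ) :
    ∀ᵐ x ∂μ, (P ^ m) x B = B.indicator 1 x := by
  induction m with
  | zero =>
    refine Filter.Eventually.of_forall fun x => ?_
    change Kernel.id x B = _
    rw [Kernel.id_apply, Measure.dirac_apply' _ hB]
  | succ m ih =>
    rw [← hμ.def] at ih
    filter_upwards [Measure.ae_ae_of_ae_comp ih, h] with x hx hx'
    have h1 : P ^ (m + 1) = (P ^ m) ∘ₖ P := pow_succ P m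
    rw [h1, Kernel.comp_apply' _ _ _ hB, lintegral_congr_ae hx, lintegral_indicator_one hB, hx']

lemma isErgodicInvariant_of_tendsto [IsProbabilityMeasure μ] (hμ : P.Invariant μ)
    (h : ∀ x s, MeasurableSet s →
      Filter.Tendsto (fun m => (P ^ m) x s) Filter.atTop (nhds (μ s))) :
    IsErgodicInvariant P μ := by
  refine ⟨inferInstance, hμ, fun B hB hPB => ?_⟩
  have h1 : ∀ᵐ x ∂μ, ∀ m, (P ^ m) x B = B.indicator 1 x :=
    ae_all_iff.2 (pow_apply_eq_indicator_of_ae_eq hμ hB hPB)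
  obtain ⟨x, hx⟩ := h1.exists
  have h2 := h x B hB
  simp only [hx] at h2
  have h3 := tendsto_nhds_unique tendsto_const_nhds h2
  by_cases hxB : x ∈ B
  · right; rw [← h3]; simp [hxB]
  · left; rw [← h3]; simp [hxB]

end Attracting

/-! ### Existence of an invariant measure -/

lemma add_sum_range_eq_add_sum_range {R : Type*} [AddCommMonoid R] {a δ ε : ℕ → R}
    (h : ∀ k, a (k + 1) + δ k = a k + ε k) (N : ℕ) :
    a N + ∑ k ∈ Finset.range N, δ k = a 0 + ∑ k ∈ Finset.range N, ε k := by
  induction N with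
  | zero => simp
  | succ N ih =>
    rw [Finset.sum_range_succ_comm, Finset.sum_range_succ, ← add_assoc, ← add_assoc, h N, ← ih,
      add_right_comm]

lemma ENNReal.tendsto_of_add_eq_add {a δ ε : ℕ → ℝ≥0∞} (ha : a 0 ≠ ∞)
    (h : ∀ k, a (k + 1) + δ k = a k + ε k) (hδ : ∑' k, δ k ≠ ∞) (hε : ∑' k, ε k ≠ ∞) :
    Filter.Tendsto a Filter.atTop (nhds (a 0 + ∑' k, ε k - ∑' k, δ k)) := by
  have hfin : ∀ N, ∑ k ∈ Finset.range N, δ k ≠ ∞ := fun N =>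
    ne_top_of_le_ne_top hδ (ENNReal.sum_le_tsum _)
  have h1 := add_sum_range_eq_add_sum_range h
  have h2 : a = fun N => a 0 + ∑ k ∈ Finset.range N, ε k - ∑ k ∈ Finset.range N, δ k := by
    ext N
    rw [← h1 N, ENNReal.add_sub_cancel_right (hfin N)]
  have h3 := ENNReal.Tendsto.sub
    (tendsto_const_nhds.add (ENNReal.tendsto_nat_tsum ε) :
      Filter.Tendsto (fun N => a 0 + ∑ k ∈ Finset.range N, ε k) _ _)
    (ENNReal.tendsto_nat_tsum δ) (Or.inl (ENNReal.add_ne_top.2 ⟨ha, hε⟩))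
  rw [h2]
  simpa using h3

/-- The invariant measure is the limit of `P ^ k x₀`. If `π_k` couples `P ^ k x₀` with
`P ^ (k + 1) x₀`, and `δ_k`, `ε_k` denote the marginals of its restriction to the complement of the
diagonal, then `P ^ (k + 1) x₀ + δ_k = P ^ k x₀ + ε_k`, and the masses of `δ_k`, `ε_k` are bounded
by the geometrically decreasing cost of `π_k`; hence the limit is
`dirac x₀ + ∑ ε_k - ∑ δ_k`. This also bounds the integral of any function dominated by the cost. -/
theorem IsContractiveCoupling.exists_invariant [MeasurableEq X] {P : Kernel X X}
    [IsMarkovKernel P] {d : X → X → ℝ} {κ : ℝ≥0∞}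
    {Q : Kernel (X × X) (X × X)} (hQ : IsContractiveCoupling P d κ Q)
    (hd : Measurable fun p : X × X => ENNReal.ofReal (d p.1 p.2)) (hκ : κ < 1)
    (hd1 : ∀ x y, x ≠ y → 1 ≤ d x y) (x₀ : X)
    (hx₀ : ∫⁻ y, ENNReal.ofReal (d x₀ y) ∂(P x₀) ≠ ∞)
    {f : X → ℝ≥0∞} (hf : Measurable f) (hfd : ∀ x y, x ≠ y → f y ≤ ENNReal.ofReal (d x y))
    (hfx₀ : f x₀ ≠ ∞) :
    ∃ μ : Measure X, IsProbabilityMeasure μ ∧ P.Invariant μ ∧ ∫⁻ y, f y ∂μ ≠ ∞ := by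
  set D : Set (X × X) := (Set.diagonal X)ᶜ with hD_def
  have hD : MeasurableSet D := measurableSet_diagonal.compl
  -- `π k` couples `P ^ k x₀` with `P ^ (k + 1) x₀`
  let π : ℕ → Measure (X × X) :=
    fun k => Nat.rec ((P x₀).map (Prod.mk x₀)) (fun _ ρ => Q ∘ₘ ρ) k
  have hπ_succ : ∀ k, π (k + 1) = Q ∘ₘ π k := fun k => rfl
  let c := ∫⁻ p, ENNReal.ofReal (d p.1 p.2) ∂(π 0)
  have hc : c ≠ ∞ := by
    change ∫⁻ p, ENNReal.ofReal (d p.1 p.2) ∂((P x₀).map (Prod.mk x₀)) ≠ ∞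
    rwa [lintegral_map hd (by fun_prop)]
  have hcost : ∀ k, ∫⁻ p, ENNReal.ofReal (d p.1 p.2) ∂(π k) ≤ κ ^ k * c := by
    intro k
    induction k with
    | zero => simp [c]
    | succ k ih =>
      rw [pow_succ', mul_assoc]
      exact (hQ.lintegral_comp_le hd _).trans (by gcongr)
  have hsum : ∑' k, κ ^ k * c ≠ ∞ := by
    rw [ENNReal.tsum_mul_right, ENNReal.tsum_geometric]
    exact ENNReal.mul_ne_top (ENNReal.inv_ne_top.2 (tsub_pos_of_lt hκ).ne') hc
  have hsum_cost : ∑' k, ∫⁻ p, ENNReal.ofReal (d p.1 p.2) ∂(π k) ≠ ∞ :=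
    ne_top_of_le_ne_top hsum (ENNReal.tsum_le_tsum hcost)
  have hfst : ∀ k, (π k).map Prod.fst = (P ^ k) x₀ := by
    intro k
    induction k with
    | zero =>
      change ((P x₀).map (Prod.mk x₀)).map Prod.fst = Kernel.id x₀
      rw [Measure.map_map measurable_fst (by fun_prop), Kernel.id_apply]
      simp [Function.comp_def]
    | succ k ih => rw [hπ_succ, hQ.map_fst_comp, ih, pow_succ']; rfl
  have hsnd : ∀ k, (π k).map Prod.snd = (P ^ (k + 1)) x₀ := by
    intro k
    induction k with
    | zero =>
      change ((P x₀).map (Prod.mk x₀)).map Prod.snd = _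
      rw [Measure.map_map measurable_snd (by fun_prop), zero_add, pow_one]
      simp [Function.comp_def]
    | succ k ih => rw [hπ_succ, hQ.map_snd_comp, ih, pow_succ' P (k + 1)]; rfl
  let δ : ℕ → Measure X := fun k => ((π k).restrict D).map Prod.fst
  let ε : ℕ → Measure X := fun k => ((π k).restrict D).map Prod.snd
  have hbal : ∀ k, (P ^ (k + 1)) x₀ + δ k = (P ^ k) x₀ + ε k := by
    intro k
    ext s hs
    rw [← hfst k, ← hsnd k]
    have e1 : MeasurableSet (Prod.fst ⁻¹' s : Set (X × X)) := measurable_fst hs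
    have e2 : MeasurableSet (Prod.snd ⁻¹' s : Set (X × X)) := measurable_snd hs
    simp only [Measure.coe_add, Pi.add_apply, δ, ε]
    rw [Measure.map_apply measurable_fst hs, Measure.map_apply measurable_snd hs,
      Measure.map_apply measurable_fst hs, Measure.map_apply measurable_snd hs,
      Measure.restrict_apply e1, Measure.restrict_apply e2,
      ← measure_inter_add_sdiff (Prod.fst ⁻¹' s) hD, ← measure_inter_add_sdiff (Prod.snd ⁻¹' s) hD]
    have : (Prod.fst ⁻¹' s \ D : Set (X × X)) = Prod.snd ⁻¹' s \ D := by
      ext ⟨x, y⟩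
      simp only [hD_def, Set.mem_sdiff, Set.mem_preimage, Set.mem_compl_iff, not_not,
        Set.mem_diagonal_iff]
      constructor <;> rintro ⟨h, rfl⟩ <;> exact ⟨h, rfl⟩
    rw [this]
    ring
  have hbal_comp : ∀ k, (P ^ (k + 1 + 1)) x₀ + P ∘ₘ δ k = (P ^ (k + 1)) x₀ + P ∘ₘ ε k := by
    intro k
    have h1 : ∀ j, (P ^ (j + 1)) x₀ = P ∘ₘ (P ^ j) x₀ := fun j => by rw [pow_succ']; rfl
    rw [h1 (k + 1), ← Measure.comp_add, hbal, Measure.comp_add, ← h1 k]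
  have hπD : ∀ k, π k D ≤ ∫⁻ p, ENNReal.ofReal (d p.1 p.2) ∂(π k) := fun k =>
    measure_compl_diagonal_le hd1 (π k)
  have hδ_univ : ∀ k, δ k Set.univ = π k D := fun k => by
    simp [δ, Measure.map_apply measurable_fst]
  have hε_univ : ∀ k, ε k Set.univ = π k D := fun k => by
    simp [ε, Measure.map_apply measurable_snd]
  have hπD_sum : ∑' k, π k D ≠ ∞ := ne_top_of_le_ne_top hsum_cost (ENNReal.tsum_le_tsum hπD)
  have hδ_fin : IsFiniteMeasure (Measure.sum δ) :=
    ⟨by simpa [Measure.sum_apply, hδ_univ, lt_top_iff_ne_top] using hπD_sum⟩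
  have hε_fin : IsFiniteMeasure (Measure.sum ε) :=
    ⟨by simpa [Measure.sum_apply, hε_univ, lt_top_iff_ne_top] using hπD_sum⟩
  have h0 : ∀ s, (P ^ 0) x₀ s = Measure.dirac x₀ s := fun s => by
    change Kernel.id x₀ s = _
    rw [Kernel.id_apply]
  -- setwise convergence of the laws `P ^ k x₀`, from two expressions of their increments
  have hlim : ∀ s, MeasurableSet s → Filter.Tendsto (fun k => (P ^ k) x₀ s) Filter.atTop
      (nhds (Measure.dirac x₀ s + Measure.sum ε s - Measure.sum δ s)) := by
    intro s hs
    rw [← h0, Measure.sum_apply _ hs, Measure.sum_apply _ hs]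
    refine ENNReal.tendsto_of_add_eq_add (measure_ne_top _ _) (fun k => ?_) ?_ ?_
    · simpa using congrArg (fun ρ : Measure X => ρ s) (hbal k)
    · rw [← Measure.sum_apply _ hs]; exact measure_ne_top _ _
    · rw [← Measure.sum_apply _ hs]; exact measure_ne_top _ _
  have hPδ : ∀ s, MeasurableSet s → (P ∘ₘ Measure.sum δ) s = ∑' k, (P ∘ₘ δ k) s := by
    intro s hs
    simp only [Measure.bind_apply hs P.measurable.aemeasurable, lintegral_sum_measure]
  have hPε : ∀ s, MeasurableSet s → (P ∘ₘ Measure.sum ε) s = ∑' k, (P ∘ₘ ε k) s := by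
    intro s hs
    simp only [Measure.bind_apply hs P.measurable.aemeasurable, lintegral_sum_measure]
  have hlim' : ∀ s, MeasurableSet s → Filter.Tendsto (fun k => (P ^ (k + 1)) x₀ s) Filter.atTop
      (nhds (P x₀ s + (P ∘ₘ Measure.sum ε) s - (P ∘ₘ Measure.sum δ) s)) := by
    intro s hs
    have h0 : P x₀ s = (P ^ (0 + 1)) x₀ s := by simp
    rw [h0, hPδ s hs, hPε s hs]
    refine ENNReal.tendsto_of_add_eq_add (a := fun k => (P ^ (k + 1)) x₀ s)
      (measure_ne_top _ _) (fun k => ?_) ?_ ?_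
    · simpa using congrArg (fun ρ : Measure X => ρ s) (hbal_comp k)
    · rw [← hPδ s hs]; exact measure_ne_top _ _
    · rw [← hPε s hs]; exact measure_ne_top _ _
  have hle : Measure.sum δ ≤ Measure.dirac x₀ + Measure.sum ε := by
    refine Measure.le_iff.2 fun s hs => ?_
    rw [Measure.sum_apply _ hs, ENNReal.tsum_eq_iSup_nat]
    refine iSup_le fun N => ?_
    have h1 := add_sum_range_eq_add_sum_range (a := fun k => (P ^ k) x₀ s) (δ := fun k => δ k s)
      (ε := fun k => ε k s)
      (fun k => by simpa using congrArg (fun ρ : Measure X => ρ s) (hbal k)) N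
    simp only [h0 s] at h1
    calc ∑ k ∈ Finset.range N, δ k s ≤ (P ^ N) x₀ s + ∑ k ∈ Finset.range N, δ k s :=
          le_add_self
      _ = Measure.dirac x₀ s + ∑ k ∈ Finset.range N, ε k s := h1
      _ ≤ (Measure.dirac x₀ + Measure.sum ε) s := by
          rw [Measure.coe_add, Pi.add_apply, Measure.sum_apply _ hs]
          gcongr
          exact ENNReal.sum_le_tsum _
  let μ := Measure.dirac x₀ + Measure.sum ε - Measure.sum δ
  have hμδ : μ + Measure.sum δ = Measure.dirac x₀ + Measure.sum ε :=
    Measure.sub_add_cancel_of_le hle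
  have hμ_apply : ∀ s, MeasurableSet s →
      μ s = Measure.dirac x₀ s + Measure.sum ε s - Measure.sum δ s := fun s hs => by
    rw [Measure.sub_apply hs hle, Measure.coe_add, Pi.add_apply]
  refine ⟨μ, ⟨?_⟩, ?_, ?_⟩
  · have := hlim Set.univ .univ
    rw [← hμ_apply _ .univ] at this
    simp only [measure_univ] at this
    exact tendsto_nhds_unique this tendsto_const_nhds
  · ext s hs
    have h1 := (hlim s hs).comp (Filter.tendsto_add_atTop_nat 1)
    rw [← hμ_apply s hs] at h1
    rw [tendsto_nhds_unique h1 (hlim' s hs)]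
    have h2 := congrArg (fun ρ : Measure X => (P ∘ₘ ρ) s) hμδ
    have h3 : P ∘ₘ Measure.dirac x₀ = P x₀ := Measure.dirac_bind P.measurable x₀
    simp only [Measure.comp_add, Measure.coe_add, Pi.add_apply, h3] at h2
    rw [← h2, ENNReal.add_sub_cancel_right (measure_ne_top _ _)]
  · refine ne_top_of_le_ne_top ?_ (lintegral_mono' (Measure.sub_le :
      μ ≤ Measure.dirac x₀ + Measure.sum ε) le_rfl)
    rw [lintegral_add_measure, lintegral_dirac' _ hf, lintegral_sum_measure]
    refine ENNReal.add_ne_top.2 ⟨hfx₀, ne_top_of_le_ne_top hsum_cost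
      (ENNReal.tsum_le_tsum fun k => ?_)⟩
    rw [lintegral_map hf measurable_snd]
    refine (setLIntegral_mono hd fun p hp => hfd p.1 p.2 hp).trans
      (setLIntegral_le_lintegral _ _)

end Coupling

/-! ### A contractive coupling from drift and minorization -/

section Harris

variable {X : Type*} [MeasurableSpace X]

lemma measurable_ofReal_weightedDist [MeasurableEq X] {V : X → ℝ} (hV : Measurable V) (β : ℝ) :
    Measurable fun p : X × X => ENNReal.ofReal (weightedDist β V p.1 p.2) := by
  refine ENNReal.measurable_ofReal.comp ?_
  unfold weightedDist
  exact Measurable.ite measurableSet_diagonal measurable_const (by fun_prop)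

lemma ofReal_weightedDist_le {X : Type*} {V : X → ℝ} (hV : ∀ x, 0 ≤ V x) {β : ℝ} (hβ : 0 ≤ β)
    (x y : X) :
    ENNReal.ofReal (weightedDist β V x y) ≤
      (1 + ENNReal.ofReal (β * V x)) + (1 + ENNReal.ofReal (β * V y)) := by
  have hx := mul_nonneg hβ (hV x)
  have hy := mul_nonneg hβ (hV y)
  rw [← ENNReal.ofReal_one, ← ENNReal.ofReal_add zero_le_one hx,
    ← ENNReal.ofReal_add zero_le_one hy, ← ENNReal.ofReal_add (by linarith) (by linarith)]
  refine ENNReal.ofReal_le_ofReal ?_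
  unfold weightedDist
  split_ifs <;> linarith

/-- The cost of any coupling is at most the sum of the weighted masses of its marginals. -/
lemma lintegral_weightedDist_le {V : X → ℝ} (hVm : Measurable V) (hV : ∀ x, 0 ≤ V x) {β : ℝ}
    (hβ : 0 ≤ β) {π : Measure (X × X)} {μ ν : Measure X} (h1 : π.map Prod.fst = μ)
    (h2 : π.map Prod.snd = ν) :
    ∫⁻ p, ENNReal.ofReal (weightedDist β V p.1 p.2) ∂π ≤
      (μ Set.univ + ∫⁻ x, ENNReal.ofReal (β * V x) ∂μ) +
        (ν Set.univ + ∫⁻ x, ENNReal.ofReal (β * V x) ∂ν) := by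
  have hm : Measurable fun x => 1 + ENNReal.ofReal (β * V x) := by fun_prop
  calc _ ≤ ∫⁻ p, (1 + ENNReal.ofReal (β * V p.1)) + (1 + ENNReal.ofReal (β * V p.2)) ∂π :=
        lintegral_mono fun p => ofReal_weightedDist_le hV hβ p.1 p.2
    _ = ∫⁻ x, 1 + ENNReal.ofReal (β * V x) ∂μ + ∫⁻ x, 1 + ENNReal.ofReal (β * V x) ∂ν := by
        rw [lintegral_add_left (by fun_prop), ← h1, ← h2, lintegral_map hm measurable_fst,
          lintegral_map hm measurable_snd]
    _ = _ := by
        rw [lintegral_add_left measurable_const, lintegral_add_left measurable_const]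
        simp

lemma GeometricDrift.lintegral_le {P : Kernel X X} {V : X → ℝ} {γ K : ℝ}
    (h : GeometricDrift P V γ K) (hV : ∀ x, 0 ≤ V x) {β : ℝ} (hβ : 0 ≤ β) (x : X) :
    ∫⁻ y, ENNReal.ofReal (β * V y) ∂(P x) ≤ ENNReal.ofReal (β * (γ * V x + K)) := by
  rw [← ofReal_integral_eq_lintegral_ofReal ((h x).1.const_mul β)
    (Filter.Eventually.of_forall fun y => mul_nonneg hβ (hV y)), integral_const_mul]
  exact ENNReal.ofReal_le_ofReal (mul_le_mul_of_nonneg_left (h x).2 hβ)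

/-- On the set `s`, the part `P x - c • ν` of the transition law that is left after removing the
common component `c • ν`, multiplied by `a`; it is `P x` off `s`. -/
noncomputable def residualKernel (P : Kernel X X) (ν : Measure X) [IsFiniteMeasure ν] (a c : ℝ≥0∞)
    (hc : c ≠ ∞) (s : Set X) (hs : MeasurableSet s) (h : ∀ x ∈ s, c • ν ≤ P x) : Kernel X X where
  toFun x := open Classical in if x ∈ s then a • (P x - c • ν) else P x
  measurable' := by
    classical
    have : IsFiniteMeasure (c • ν) := ν.smul_finite hc
    refine Measure.measurable_of_measurable_coe _ fun t ht => ?_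
    have : (fun x => (if x ∈ s then a • (P x - c • ν) else P x) t) =
        fun x => if x ∈ s then a * (P x t - (c • ν) t) else P x t := by
      ext x
      split_ifs with hx
      · rw [Measure.smul_apply, Measure.sub_apply ht (h x hx), smul_eq_mul]
      · rfl
    rw [this]
    exact Measurable.ite hs (((P.measurable_coe ht).sub measurable_const).const_mul a)
      (P.measurable_coe ht)

section residualKernel

variable {P : Kernel X X} {ν : Measure X} [IsFiniteMeasure ν] {a c : ℝ≥0∞} {hc : c ≠ ∞}
  {s : Set X} {hs : MeasurableSet s} (h : ∀ x ∈ s, c • ν ≤ P x) {x : X}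

lemma residualKernel_of_mem (hx : x ∈ s) :
    residualKernel P ν a c hc s hs h x = a • (P x - c • ν) :=
  if_pos hx

lemma residualKernel_of_notMem (hx : x ∉ s) : residualKernel P ν a c hc s hs h x = P x :=
  if_neg hx

end residualKernel

/-- The arithmetic behind the contraction: far from the origin (`R ≤ s`) the drift wins, and near
it the mass `b` that is coupled exactly wins. -/
lemma exists_contraction_rate {γ K R b : ℝ} (hγ : γ < 1) (hK : 0 ≤ K)
    (hR : 2 * K / (1 - γ) < R) (hb0 : 0 < b) (hb1 : b < 1) :
    ∃ β : ℝ, 0 < β ∧ ∃ κ : ℝ, 0 < κ ∧ κ < 1 ∧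
      (∀ s, R ≤ s → 2 + β * (γ * s + 2 * K) ≤ κ * (2 + β * s)) ∧
      (∀ s, 0 ≤ s → 2 * (1 - b) + β * (γ * s + 2 * K) ≤ κ * (2 + β * s)) := by
  have hγ' : 0 < 1 - γ := by linarith
  have hR0 : 0 < R := lt_of_le_of_lt (by positivity) hR
  rw [div_lt_iff₀ hγ'] at hR
  have hβ : 0 < b / (2 * K + 1) := by positivity
  -- with this weight the constant `2 * K` costs at most half of what the exact coupling gains
  have hβK : b / (2 * K + 1) * (2 * K) ≤ b := by
    rw [div_mul_eq_mul_div, div_le_iff₀ (by positivity)]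
    nlinarith
  refine ⟨b / (2 * K + 1), hβ, ?_⟩
  generalize b / (2 * K + 1) = β at hβ hβK
  have hβR : 0 < 2 + β * R := by positivity
  refine ⟨max (max γ (1 - b / 2)) ((2 + β * (γ * R + 2 * K)) / (2 + β * R)), ?_, ?_, ?_, ?_⟩
  · exact lt_max_of_lt_left (lt_max_of_lt_right (by linarith))
  · refine max_lt (max_lt hγ (by linarith)) ?_
    rw [div_lt_one hβR]
    nlinarith
  · intro s hs
    have h1 := le_max_right (max γ (1 - b / 2)) ((2 + β * (γ * R + 2 * K)) / (2 + β * R))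
    have h2 := (le_max_left γ (1 - b / 2)).trans
      (le_max_left (max γ (1 - b / 2)) ((2 + β * (γ * R + 2 * K)) / (2 + β * R)))
    generalize max (max γ (1 - b / 2)) ((2 + β * (γ * R + 2 * K)) / (2 + β * R)) = κ at h1 h2
    rw [div_le_iff₀ hβR] at h1
    nlinarith [mul_nonneg (mul_nonneg hβ.le (sub_nonneg.2 h2)) (sub_nonneg.2 hs)]
  · intro s hs
    have h1 := (le_max_right γ (1 - b / 2)).trans
      (le_max_left (max γ (1 - b / 2)) ((2 + β * (γ * R + 2 * K)) / (2 + β * R)))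
    have h2 := (le_max_left γ (1 - b / 2)).trans
      (le_max_left (max γ (1 - b / 2)) ((2 + β * (γ * R + 2 * K)) / (2 + β * R)))
    generalize max (max γ (1 - b / 2)) ((2 + β * (γ * R + 2 * K)) / (2 + β * R)) = κ at h1 h2
    nlinarith [mul_nonneg (mul_nonneg hβ.le (sub_nonneg.2 h2)) hs]

/-- **Contraction from drift and minorization.** Two copies of the chain move together once they
have met; they are coupled through the common component of their laws while `V x + V y < R`, and
independently otherwise. -/
theorem exists_isContractiveCoupling [MeasurableEq X] {P : Kernel X X} [IsMarkovKernel P]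
    {V : X → ℝ} (hVm : Measurable V) (hV : ∀ x, 0 ≤ V x) {γ K R : ℝ} (hγ : γ < 1) (hK : 0 ≤ K)
    (hR : 2 * K / (1 - γ) < R) (hdrift : GeometricDrift P V γ K) (hmin : Minorization P V R) :
    ∃ β : ℝ, 0 < β ∧ ∃ κ : ℝ, 0 < κ ∧ κ < 1 ∧ ∃ Q : Kernel (X × X) (X × X),
      IsContractiveCoupling P (weightedDist β V) (ENNReal.ofReal κ) Q := by
  classical
  obtain ⟨b, hb0, hb1, ν, hν, hPν⟩ := hmin
  obtain ⟨β, hβ, κ, hκ0, hκ1, hfar, hnear⟩ := exists_contraction_rate hγ hK hR hb0 hb1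
  refine ⟨β, hβ, κ, hκ0, hκ1, ?_⟩
  set c := ENNReal.ofReal b with hc_def
  have hc : c ≠ ∞ := ENNReal.ofReal_ne_top
  have hc1 : 1 - c = ENNReal.ofReal (1 - b) := by
    rw [hc_def, ← ENNReal.ofReal_one, ENNReal.ofReal_sub _ hb0.le]
  have hc0 : 1 - c ≠ 0 := by
    rw [hc1]; exact (ENNReal.ofReal_pos.2 (by linarith)).ne'
  have hc2 : 1 - c ≠ ∞ := by rw [hc1]; exact ENNReal.ofReal_ne_top
  have : IsFiniteMeasure (c • ν) := ν.smul_finite hc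
  have hs : MeasurableSet {x | V x ≤ R} := measurableSet_le hVm measurable_const
  -- `A x` has mass `1 - c`, and `A' x` is its normalization
  let A := residualKernel P ν 1 c hc {x | V x ≤ R} hs hPν
  let A' := residualKernel P ν (1 - c)⁻¹ c hc {x | V x ≤ R} hs hPν
  have hA : ∀ x, V x ≤ R → A x = P x - c • ν := fun x hx =>
    (residualKernel_of_mem hPν hx).trans (one_smul _ _)
  have hA' : ∀ x, V x ≤ R → A' x = (1 - c)⁻¹ • (P x - c • ν) := fun x hx =>
    residualKernel_of_mem hPν hx
  have hsub : ∀ x, V x ≤ R → (P x - c • ν) Set.univ = 1 - c := fun x hx => by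
    rw [Measure.sub_apply .univ (hPν x hx)]; simp
  have hAfin : IsFiniteKernel A := by
    refine ⟨1, ENNReal.one_lt_top, fun x => ?_⟩
    by_cases hx : V x ≤ R
    · rw [hA x hx, hsub x hx]; exact tsub_le_self
    · rw [show A x = P x from residualKernel_of_notMem hPν hx]; exact prob_le_one
  have hA'fin : IsMarkovKernel A' := by
    refine ⟨fun x => ⟨?_⟩⟩
    by_cases hx : V x ≤ R
    · rw [hA' x hx, Measure.smul_apply, hsub x hx, smul_eq_mul, ENNReal.inv_mul_cancel hc0 hc2]
    · rw [show A' x = P x from residualKernel_of_notMem hPν hx]; exact measure_univ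
  have hS : MeasurableSet {p : X × X | V p.1 + V p.2 < R} :=
    measurableSet_lt (by fun_prop) measurable_const
  have hdiag : Measurable fun x : X => (x, x) := by fun_prop
  let Q : Kernel (X × X) (X × X) :=
    Kernel.piecewise measurableSet_diagonal
      ((P.comap Prod.fst measurable_fst).map fun x => (x, x))
      (Kernel.piecewise hS
        (Kernel.const _ ((c • ν).map fun x => (x, x)) + A.parallelComp A') (P.parallelComp P))
  have hQ1 : ∀ x, Q (x, x) = (P x).map fun x => (x, x) := fun x => by
    simp [Q, Kernel.piecewise_apply, Kernel.map_apply _ hdiag]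
  have hQ2 : ∀ x y, x ≠ y → V x + V y < R →
      Q (x, y) = (c • ν).map (fun x => (x, x)) + (A x).prod (A' y) := fun x y hxy h => by
    simp [Q, Kernel.piecewise_apply, hxy, h, Kernel.parallelComp_apply]
  have hQ3 : ∀ x y, x ≠ y → ¬ V x + V y < R → Q (x, y) = (P x).prod (P y) := fun x y hxy h => by
    simp only [Q, Kernel.piecewise_apply, Set.mem_diagonal_iff, hxy, Set.mem_ofPred_eq, h,
      if_false, Kernel.parallelComp_apply]
  have hVx : ∀ x y, V x + V y < R → V x ≤ R := fun x y h => by linarith [hV y]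
  have hVy : ∀ x y, V x + V y < R → V y ≤ R := fun x y h => by linarith [hV x]
  have hprod1 : ∀ x y, V x + V y < R →
      ((A x).prod (A' y)).map Prod.fst = P x - c • ν := fun x y h => by
    rw [Measure.map_fst_prod, measure_univ, one_smul, hA x (hVx x y h)]
  have hprod2 : ∀ x y, V x + V y < R →
      ((A x).prod (A' y)).map Prod.snd = P y - c • ν := fun x y h => by
    rw [Measure.map_snd_prod, hA x (hVx x y h), hsub x (hVx x y h), hA' y (hVy x y h), smul_smul,
      ENNReal.mul_inv_cancel hc0 hc2, one_smul]
  have hd := measurable_ofReal_weightedDist hVm β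
  refine ⟨Q, ?_, ?_, ?_⟩
  · rintro ⟨x, y⟩
    rcases eq_or_ne x y with rfl | hxy
    · rw [hQ1, Measure.map_map measurable_fst hdiag]
      simp [Function.comp_def]
    by_cases h : V x + V y < R
    · rw [hQ2 x y hxy h, Measure.map_add _ _ measurable_fst, hprod1 x y h,
        Measure.map_map measurable_fst hdiag]
      change (c • ν).map id + _ = P x
      rw [Measure.map_id, add_comm, Measure.sub_add_cancel_of_le (hPν x (hVx x y h))]
    · rw [hQ3 x y hxy h]; simp
  · rintro ⟨x, y⟩
    rcases eq_or_ne x y with rfl | hxy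
    · rw [hQ1, Measure.map_map measurable_snd hdiag]
      simp [Function.comp_def]
    by_cases h : V x + V y < R
    · rw [hQ2 x y hxy h, Measure.map_add _ _ measurable_snd, hprod2 x y h,
        Measure.map_map measurable_snd hdiag]
      change (c • ν).map id + _ = P y
      rw [Measure.map_id, add_comm, Measure.sub_add_cancel_of_le (hPν y (hVy x y h))]
    · rw [hQ3 x y hxy h]; simp
  · have hzero : ∀ μ : Measure X,
        ∫⁻ p, ENNReal.ofReal (weightedDist β V p.1 p.2) ∂(μ.map fun x => (x, x)) = 0 := by
      intro μ
      rw [lintegral_map hd hdiag]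
      simp [weightedDist]
    have hdr0 : ∀ x, 0 ≤ β * (γ * V x + K) := fun x =>
      mul_nonneg hβ.le ((integral_nonneg hV).trans (hdrift x).2)
    rintro ⟨x, y⟩
    rcases eq_or_ne x y with rfl | hxy
    · rw [hQ1, hzero]; exact zero_le
    have hdxy : weightedDist β V x y = 2 + β * (V x + V y) := by
      simp only [weightedDist, if_neg hxy]; ring
    by_cases h : V x + V y < R
    · rw [hQ2 x y hxy h, lintegral_add_measure, hzero, zero_add]
      refine (lintegral_weightedDist_le hVm hV hβ.le (hprod1 x y h) (hprod2 x y h)).trans ?_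
      rw [hsub x (hVx x y h), hsub y (hVy x y h), hc1]
      have hle : ∀ z, ∫⁻ w, ENNReal.ofReal (β * V w) ∂(P z - c • ν) ≤
          ENNReal.ofReal (β * (γ * V z + K)) := fun z =>
        (lintegral_mono' Measure.sub_le le_rfl).trans (hdrift.lintegral_le hV hβ.le z)
      refine (add_le_add (add_le_add_right (hle x) _) (add_le_add_right (hle y) _)).trans ?_
      have hb : 0 ≤ 1 - b := by linarith
      rw [← ENNReal.ofReal_add hb (hdr0 x), ← ENNReal.ofReal_add hb (hdr0 y),
        ← ENNReal.ofReal_add (add_nonneg hb (hdr0 x)) (add_nonneg hb (hdr0 y)),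
        ← ENNReal.ofReal_mul hκ0.le]
      refine ENNReal.ofReal_le_ofReal ?_
      change _ ≤ κ * weightedDist β V x y
      rw [hdxy]
      linarith [hnear (V x + V y) (add_nonneg (hV x) (hV y))]
    · rw [hQ3 x y hxy h]
      refine (lintegral_weightedDist_le (μ := P x) (ν := P y) hVm hV hβ.le (by simp)
        (by simp)).trans ?_
      rw [measure_univ, measure_univ, ← ENNReal.ofReal_one]
      refine (add_le_add (add_le_add_right (hdrift.lintegral_le hV hβ.le x) _)
        (add_le_add_right (hdrift.lintegral_le hV hβ.le y) _)).trans ?_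
      rw [← ENNReal.ofReal_add zero_le_one (hdr0 x), ← ENNReal.ofReal_add zero_le_one (hdr0 y),
        ← ENNReal.ofReal_add (add_nonneg zero_le_one (hdr0 x)) (add_nonneg zero_le_one (hdr0 y)),
        ← ENNReal.ofReal_mul hκ0.le]
      refine ENNReal.ofReal_le_ofReal ?_
      change _ ≤ κ * weightedDist β V x y
      rw [hdxy]
      linarith [hfar (V x + V y) (not_lt.1 h)]

/-- **Harris' theorem** in its geometric form: drift and minorization give a unique invariant
probability measure, which is ergodic and attracts every initial state geometrically. -/
theorem harris [MeasurableEq X] [Nonempty X] {P : Kernel X X} [IsMarkovKernel P]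
    {V : X → ℝ} (hVm : Measurable V) (hV : ∀ x, 0 ≤ V x) {γ K R : ℝ} (hγ : γ < 1) (hK : 0 ≤ K)
    (hR : 2 * K / (1 - γ) < R) (hdrift : GeometricDrift P V γ K) (hmin : Minorization P V R) :
    ∃ μ : Measure X, IsErgodicInvariant P μ ∧
      (∀ ν : Measure X, IsProbabilityMeasure ν → P.Invariant ν → ν = μ) ∧
      ∃ β : ℝ, 0 < β ∧ ∃ κ : ℝ, 0 < κ ∧ κ < 1 ∧
        (∀ x y : X, wasserstein (weightedDist β V) (P x) (P y) ≤
          ENNReal.ofReal (κ * weightedDist β V x y)) ∧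
        (∀ x : X, wasserstein (weightedDist β V) (P x) μ < ∞) ∧
        ∃ C : ℝ, 0 < C ∧ ∀ (x : X) (m : ℕ), 1 ≤ m →
          wasserstein (weightedDist β V) ((P ^ m) x) μ ≤
            ENNReal.ofReal (C * κ ^ m) * wasserstein (weightedDist β V) (P x) μ := by
  obtain ⟨β, hβ, κ, hκ0, hκ1, Q, hQ⟩ :=
    exists_isContractiveCoupling hVm hV hγ hK hR hdrift hmin
  obtain ⟨x₀⟩ := ‹Nonempty X›
  have hd := measurable_ofReal_weightedDist hVm β
  have hd1 : ∀ x y, x ≠ y → 1 ≤ weightedDist β V x y := fun x y hxy => by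
    rw [weightedDist, if_neg hxy]
    linarith [mul_nonneg hβ.le (hV x), mul_nonneg hβ.le (hV y)]
  have hκ0' : ENNReal.ofReal κ ≠ 0 := (ENNReal.ofReal_pos.2 hκ0).ne'
  have hκ1' : ENNReal.ofReal κ < 1 := by simpa using hκ1
  have hPV : ∀ x, ∫⁻ y, ENNReal.ofReal (β * V y) ∂(P x) ≠ ∞ := fun x =>
    ne_top_of_le_ne_top ENNReal.ofReal_ne_top (hdrift.lintegral_le hV hβ.le x)
  obtain ⟨μ, hμ, hinv, hμV⟩ := hQ.exists_invariant hd hκ1' hd1 x₀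
    (by
      have h := lintegral_weightedDist_le hVm hV hβ.le (π := (P x₀).map (Prod.mk x₀))
        (μ := Measure.dirac x₀) (ν := P x₀)
        (by rw [Measure.map_map measurable_fst (by fun_prop)]; simp [Function.comp_def])
        (by rw [Measure.map_map measurable_snd (by fun_prop)]; simp [Function.comp_def])
      rw [lintegral_map hd (by fun_prop), lintegral_dirac' _ (by fun_prop)] at h
      refine ne_top_of_le_ne_top ?_ h
      simp [hPV x₀])
    (f := fun y => ENNReal.ofReal (β * V y)) (by fun_prop)
    (fun x y hxy => ENNReal.ofReal_le_ofReal (by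
      rw [weightedDist, if_neg hxy]; linarith [mul_nonneg hβ.le (hV x)]))
    ENNReal.ofReal_ne_top
  have hW : ∀ x, wasserstein (weightedDist β V) (P x) μ < ∞ := fun x => by
    refine lt_of_le_of_lt (wasserstein_le_lintegral _ (π := (P x).prod μ) (by simp) (by simp))
      (lt_of_le_of_lt (lintegral_weightedDist_le (μ := P x) (ν := μ) hVm hV hβ.le (by simp)
        (by simp)) ?_)
    rw [lt_top_iff_ne_top]
    simp [hPV x, hμV]
  have hmix := fun x m => hQ.wasserstein_pow_succ_le hd hκ0' ENNReal.ofReal_ne_top hinv x m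
  have hlim : ∀ x s, MeasurableSet s →
      Filter.Tendsto (fun m => (P ^ m) x s) Filter.atTop (nhds (μ s)) := by
    intro x s hs
    rw [← Filter.tendsto_add_atTop_iff_nat 1]
    have h0 : Filter.Tendsto
        (fun m => ENNReal.ofReal κ ^ m * wasserstein (weightedDist β V) (P x) μ)
        Filter.atTop (nhds 0) := by
      simpa using ENNReal.Tendsto.mul_const
        (ENNReal.tendsto_pow_atTop_nhds_zero_of_lt_one hκ1') (Or.inr (hW x).ne)
    have hlow : Filter.Tendsto
        (fun m => μ s - ENNReal.ofReal κ ^ m * wasserstein (weightedDist β V) (P x) μ)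
        Filter.atTop (nhds (μ s)) := by
      simpa using ENNReal.Tendsto.sub (tendsto_const_nhds (x := μ s)) h0
        (Or.inl (measure_ne_top _ _))
    have hup : Filter.Tendsto
        (fun m => μ s + ENNReal.ofReal κ ^ m * wasserstein (weightedDist β V) (P x) μ)
        Filter.atTop (nhds (μ s)) := by
      simpa using (tendsto_const_nhds (x := μ s)).add h0
    refine tendsto_of_tendsto_of_tendsto_of_le_of_le hlow hup (fun m => ?_) fun m => ?_
    · exact tsub_le_iff_right.2 ((measure_le_add_wasserstein hd1 ((P ^ (m + 1)) x) μ hs).2.trans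
        (add_le_add_right (hmix x m) _))
    · exact (measure_le_add_wasserstein hd1 ((P ^ (m + 1)) x) μ hs).1.trans
        (add_le_add_right (hmix x m) _)
  refine ⟨μ, isErgodicInvariant_of_tendsto hinv hlim,
    fun ν hν hνinv => eq_of_invariant_of_tendsto hlim hνinv, β, hβ, κ, hκ0, hκ1, ?_, hW,
    κ⁻¹, inv_pos.2 hκ0, ?_⟩
  · intro x y
    refine (wasserstein_le_lintegral _ (hQ.map_fst (x, y)) (hQ.map_snd (x, y))).trans ?_
    rw [ENNReal.ofReal_mul hκ0.le]
    exact hQ.lintegral_le (x, y)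
  · intro x m hm
    obtain ⟨k, rfl⟩ := Nat.exists_eq_add_of_le' hm
    have h1 : κ⁻¹ * κ ^ (k + 1) = κ ^ k := by
      rw [pow_succ', inv_mul_cancel_left₀ hκ0.ne']
    rw [h1, ENNReal.ofReal_pow hκ0.le]
    exact hmix x k

end Harris

/-! ### Gaussian laws with identity covariance -/

section Gaussian

lemma MeasureTheory.Measure.smul_pi_le_pi {ι : Type*} [Fintype ι] {α : ι → Type*}
    [∀ i, MeasurableSpace (α i)] (c : ι → ℝ≥0∞) {μ ν : ∀ i, Measure (α i)}
    [∀ i, SigmaFinite (μ i)] [∀ i, SigmaFinite (ν i)] (h : ∀ i, c i • ν i ≤ μ i) :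
    (∏ i, c i) • Measure.pi ν ≤ Measure.pi μ := by
  have h1 : ((∏ i, c i) • Measure.pi ν).toOuterMeasure ≤
      OuterMeasure.pi fun i => (μ i).toOuterMeasure := by
    refine OuterMeasure.le_pi.2 fun s _ => ?_
    change ((∏ i, c i) • Measure.pi ν) (Set.univ.pi s) ≤ ∏ i, μ i (s i)
    rw [Measure.smul_apply, Measure.pi_pi, smul_eq_mul, ← Finset.prod_mul_distrib]
    exact Finset.prod_le_prod' fun i _ => by simpa using h i (s i)
  refine Measure.le_iff.2 fun s hs => ?_
  have h2 : Measure.pi μ s = OuterMeasure.pi (fun i => (μ i).toOuterMeasure) s :=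
    by rw [Measure.pi_def]; exact toMeasure_apply _ _ hs
  rw [h2]
  exact h1 s

/-- Moving the mean of a standard normal law to `m` keeps a multiple of a narrower centred one,
since `(y - m) ^ 2 / 2 ≤ y ^ 2 + m ^ 2`. -/
lemma smul_gaussianReal_le (m : ℝ) :
    ENNReal.ofReal (Real.exp (-m ^ 2) / 2) • gaussianReal 0 (1 / 2) ≤ gaussianReal m 1 := by
  rw [gaussianReal_of_var_ne_zero _ (by norm_num), gaussianReal_of_var_ne_zero _ one_ne_zero,
    ← withDensity_smul _ (measurable_gaussianPDF _ _)]
  refine withDensity_mono (Filter.Eventually.of_forall fun y => ?_)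
  rw [Pi.smul_apply, smul_eq_mul, gaussianPDF, gaussianPDF, ← ENNReal.ofReal_mul (by positivity)]
  refine ENNReal.ofReal_le_ofReal ?_
  rw [gaussianPDFReal_def, gaussianPDFReal_def]
  have e1 : (((1 / 2 : NNReal)) : ℝ) = 1 / 2 := by norm_num
  simp only [e1, NNReal.coe_one, mul_one, sub_zero]
  have hpi := Real.pi_pos
  have h1 : √(2 * Real.pi) ≤ 2 * √(2 * Real.pi * (1 / 2)) := by
    rw [Real.sqrt_le_left (by positivity), mul_pow, Real.sq_sqrt (by positivity)]
    linarith
  have h2 : (√(2 * Real.pi * (1 / 2)))⁻¹ / 2 ≤ (√(2 * Real.pi))⁻¹ := by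
    rw [div_eq_mul_inv, ← mul_inv, mul_comm]
    exact inv_anti₀ (by positivity) h1
  have h3 : Real.exp (-m ^ 2) * Real.exp (-y ^ 2 / (2 * (1 / 2))) ≤
      Real.exp (-(y - m) ^ 2 / 2) := by
    rw [← Real.exp_add]
    refine Real.exp_le_exp.2 ?_
    linarith [sq_nonneg (y + m)]
  calc Real.exp (-m ^ 2) / 2 *
        ((√(2 * Real.pi * (1 / 2)))⁻¹ * Real.exp (-y ^ 2 / (2 * (1 / 2))))
      = ((√(2 * Real.pi * (1 / 2)))⁻¹ / 2) *
        (Real.exp (-m ^ 2) * Real.exp (-y ^ 2 / (2 * (1 / 2)))) := by ring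
    _ ≤ _ := mul_le_mul h2 h3 (by positivity) (by positivity)

variable {n : ℕ} (m : EuclideanSpace ℝ (Fin n))

lemma multivariateGaussian_one_eq_map_add :
    multivariateGaussian m 1 = (multivariateGaussian 0 1).map (m + ·) := by
  rw [multivariateGaussian_zero_one, multivariateGaussian]
  simp

lemma multivariateGaussian_one_eq_map_pi :
    multivariateGaussian m 1 =
      (Measure.pi fun i => gaussianReal (m i) 1).map (WithLp.toLp 2) := by
  have h : (Measure.pi fun i => gaussianReal (m i) 1) =
      (Measure.pi fun _ : Fin n => gaussianReal 0 1).map fun x i => m i + x i := by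
    rw [Measure.pi_map_pi (fun i => by fun_prop)]
    simp [gaussianReal_map_const_add]
  rw [multivariateGaussian_one_eq_map_add, multivariateGaussian_zero_one, ← map_pi_eq_stdGaussian,
    h, Measure.map_map (by fun_prop) (by fun_prop), Measure.map_map (by fun_prop) (by fun_prop)]
  rfl

lemma smul_map_pi_gaussianReal_le :
    ENNReal.ofReal (Real.exp (-‖m‖ ^ 2) / 2 ^ n) •
      (Measure.pi fun _ : Fin n => gaussianReal 0 (1 / 2)).map (WithLp.toLp 2) ≤
        multivariateGaussian m 1 := by
  have h : ENNReal.ofReal (Real.exp (-‖m‖ ^ 2) / 2 ^ n) =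
      ∏ i, ENNReal.ofReal (Real.exp (-m i ^ 2) / 2) := by
    rw [← ENNReal.ofReal_prod_of_nonneg fun i _ => by positivity, Finset.prod_div_distrib,
      ← Real.exp_sum, Finset.sum_neg_distrib, EuclideanSpace.real_norm_sq_eq]
    simp
  rw [h, multivariateGaussian_one_eq_map_pi, ← Measure.map_smul]
  exact Measure.map_mono (Measure.smul_pi_le_pi _ fun i => smul_gaussianReal_le (m i))
    (by fun_prop)

lemma integrable_norm_multivariateGaussian (T : Matrix (Fin n) (Fin n) ℝ) :
    Integrable (fun y => ‖y‖) (multivariateGaussian m T) :=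
  IsGaussian.integrable_id.norm

lemma integral_norm_sq_multivariateGaussian_one :
    ∫ y, ‖y‖ ^ 2 ∂(multivariateGaussian m 1) = n + ‖m‖ ^ 2 := by
  have hL : ∀ i, MemLp (fun y : EuclideanSpace ℝ (Fin n) => y i) 2
      (multivariateGaussian m 1) := fun i =>
    (EuclideanSpace.proj i : EuclideanSpace ℝ (Fin n) →L[ℝ] ℝ).comp_memLp'
      (IsGaussian.memLp_two_id (μ := multivariateGaussian m 1))
  have hi : ∀ i, ∫ y, y i ^ 2 ∂(multivariateGaussian m 1) = 1 + m i ^ 2 := by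
    intro i
    have h1 := variance_eval_multivariateGaussian (μ := m) Matrix.PosSemidef.one i
    rw [variance_eq_sub (hL i)] at h1
    have h2 : ∫ y, y i ∂(multivariateGaussian m 1) = m i := by
      have := (EuclideanSpace.proj i : EuclideanSpace ℝ (Fin n) →L[ℝ] ℝ).integral_comp_comm
        (IsGaussian.integrable_id (μ := multivariateGaussian m 1))
      simpa using this
    simp only [Pi.pow_apply, h2, Matrix.one_apply_eq] at h1
    linarith
  simp_rw [EuclideanSpace.real_norm_sq_eq]
  rw [integral_finsetSum _ fun i _ => (hL i).integrable_sq]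
  simp [hi, Finset.sum_add_distrib]

lemma integral_norm_multivariateGaussian_one_le :
    ∫ y, ‖y‖ ∂(multivariateGaussian m 1) ≤ √(n + ‖m‖ ^ 2) := by
  have h : MemLp (fun y => ‖y‖) 2 (multivariateGaussian m 1) := IsGaussian.memLp_two_id.norm
  have h1 := variance_nonneg (fun y => ‖y‖) (multivariateGaussian m 1)
  rw [variance_eq_sub h] at h1
  simp only [Pi.pow_apply, integral_norm_sq_multivariateGaussian_one] at h1
  exact Real.le_sqrt_of_sq_le (by linarith)

end Gaussian

/-! ### The transition kernel of a switched linear dynamical system -/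

namespace SLDS

variable {n M : ℕ} (S : SLDS n M)

lemma exists_mem_region (x : EuclideanSpace ℝ (Fin n)) : ∃ j, x ∈ S.region j := by
  have := Set.mem_univ x
  rwa [← S.iUnion_region, Set.mem_iUnion] at this

lemma sum_indicator_region {β : Type*} [AddCommMonoid β]
    (f : Fin M → EuclideanSpace ℝ (Fin n) → β) {x : EuclideanSpace ℝ (Fin n)} {j : Fin M}
    (hx : x ∈ S.region j) : ∑ k, (S.region k).indicator (f k) x = f j x := by
  rw [Finset.sum_eq_single j, Set.indicator_of_mem hx]
  · intro k _ hk
    exact Set.indicator_of_notMem (Set.disjoint_right.1 (S.disjoint_region k j hk) hx) _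
  · simp

lemma transition_apply_of_mem {x : EuclideanSpace ℝ (Fin n)} {j : Fin M}
    (hx : x ∈ S.region j) : S.transition x = multivariateGaussian (S.lin j x) 1 :=
  S.sum_indicator_region (fun j z => multivariateGaussian (S.lin j z) 1) hx

instance : IsMarkovKernel S.transition := by
  refine ⟨fun x => ?_⟩
  obtain ⟨j, hj⟩ := S.exists_mem_region x
  rw [S.transition_apply_of_mem hj]
  infer_instance

/-- The regions cover the whole space, so they cannot all be proper subsets of one ball. In
dimension zero this rests on the inclusions being proper. -/
lemma exists_not_ssubset_closedBall (ϱ : ℝ) :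
    ∃ j, ¬ S.region j ⊂ Metric.closedBall 0 ϱ := by
  by_contra! h
  rcases subsingleton_or_nontrivial (EuclideanSpace ℝ (Fin n)) with hE | hE
  · obtain ⟨j, hj⟩ := S.exists_mem_region 0
    refine (h j).2 fun y _ => ?_
    rwa [Subsingleton.elim y 0]
  · obtain ⟨y, hy⟩ := NormedSpace.exists_lt_norm ℝ (EuclideanSpace ℝ (Fin n)) ϱ
    obtain ⟨j, hj⟩ := S.exists_mem_region y
    have := (h j).1 hj
    rw [mem_closedBall_zero_iff] at this
    linarith

theorem geometricDrift_transition {ϱ L γ : ℝ}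
    (h_bdd : ∀ k : Fin M, S.region k ⊂ Metric.closedBall 0 ϱ → ‖S.lin k‖ ≤ L)
    (h_compl : ∀ j : Fin M, ¬ S.region j ⊂ Metric.closedBall 0 ϱ → ‖S.lin j‖ ≤ γ) :
    GeometricDrift S.transition (fun x => ‖x‖) γ (√((n : ℝ) + L ^ 2 * ϱ ^ 2)) := by
  intro x
  obtain ⟨j₀, hj₀⟩ := S.exists_not_ssubset_closedBall ϱ
  have hγ : 0 ≤ γ := (norm_nonneg _).trans (h_compl j₀ hj₀)
  obtain ⟨j, hj⟩ := S.exists_mem_region x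
  rw [S.transition_apply_of_mem hj]
  refine ⟨integrable_norm_multivariateGaussian _ _,
    (integral_norm_multivariateGaussian_one_le _).trans ?_⟩
  have hlin := (S.lin j).le_opNorm x
  by_cases h : S.region j ⊂ Metric.closedBall 0 ϱ
  · have hx : ‖x‖ ≤ ϱ := mem_closedBall_zero_iff.1 (h.1 hj)
    have hL := h_bdd j h
    have h1 : ‖S.lin j x‖ ≤ L * ϱ :=
      hlin.trans (mul_le_mul hL hx (norm_nonneg _) ((norm_nonneg _).trans hL))
    have h2 : √((n : ℝ) + ‖S.lin j x‖ ^ 2) ≤ √((n : ℝ) + L ^ 2 * ϱ ^ 2) := by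
      rw [← mul_pow]; gcongr
    linarith [mul_nonneg hγ (norm_nonneg x)]
  · have h1 : ‖S.lin j x‖ ≤ γ * ‖x‖ :=
      hlin.trans (mul_le_mul_of_nonneg_right (h_compl j h) (norm_nonneg _))
    have h2 : √((n : ℝ) + ‖S.lin j x‖ ^ 2) ≤ √n + ‖S.lin j x‖ := by
      refine Real.sqrt_le_left (by positivity) |>.2 ?_
      rw [add_sq, Real.sq_sqrt (by positivity)]
      have : 0 ≤ 2 * √(n : ℝ) * ‖S.lin j x‖ := by positivity
      linarith
    have h3 : √(n : ℝ) ≤ √((n : ℝ) + L ^ 2 * ϱ ^ 2) :=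
      Real.sqrt_le_sqrt (le_add_of_nonneg_right (by positivity))
    linarith

theorem minorization_transition (R : ℝ) : Minorization S.transition (fun x => ‖x‖) R := by
  set ρ := (∑ j, ‖S.lin j‖) * R
  have hexp : Real.exp (-ρ ^ 2) ≤ 1 := Real.exp_le_one_iff.2 (by linarith [sq_nonneg ρ])
  -- the additional factor `2` makes the constant smaller than one also for `n = 0`
  refine ⟨Real.exp (-ρ ^ 2) / 2 ^ (n + 1), by positivity, ?_,
    (Measure.pi fun _ : Fin n => gaussianReal 0 (1 / 2)).map (WithLp.toLp 2),
    Measure.isProbabilityMeasure_map (by fun_prop), fun x hx => ?_⟩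
  · rw [div_lt_one (by positivity)]
    exact hexp.trans_lt (one_lt_pow₀ one_lt_two n.succ_ne_zero)
  · obtain ⟨j, hj⟩ := S.exists_mem_region x
    rw [S.transition_apply_of_mem hj]
    refine le_trans ?_ (smul_map_pi_gaussianReal_le (S.lin j x))
    have h1 : ‖S.lin j x‖ ≤ ρ := by
      refine ((S.lin j).le_opNorm x).trans (mul_le_mul ?_ hx (norm_nonneg _) (by positivity))
      exact Finset.single_le_sum (f := fun j => ‖S.lin j‖) (fun _ _ => norm_nonneg _)
        (Finset.mem_univ j)
    have h2 : ‖S.lin j x‖ ^ 2 ≤ ρ ^ 2 := pow_le_pow_left₀ (norm_nonneg _) h1 2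
    refine Measure.le_iff.2 fun s _ => ?_
    simp only [Measure.smul_apply, smul_eq_mul]
    refine mul_le_mul_left (ENNReal.ofReal_le_ofReal ?_) _
    refine div_le_div₀ (Real.exp_nonneg _) (Real.exp_le_exp.2 (by linarith)) (by positivity) ?_
    exact pow_le_pow_right₀ one_le_two n.le_succ

/-! ### Trajectories are Markov chains -/

lemma _root_.ProbabilityTheory.IndepFun.prodMk_left_of_prodMk_right {Ω α β γ : Type*}
    [MeasurableSpace Ω] [MeasurableSpace α] [MeasurableSpace β] [MeasurableSpace γ]
    {Pr : Measure Ω} [IsProbabilityMeasure Pr] {X : Ω → α} {Y : Ω → β} {Z : Ω → γ}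
    (hX : Measurable X) (hY : Measurable Y) (hZ : Measurable Z)
    (h : IndepFun X (fun ω => (Y ω, Z ω)) Pr) (h' : IndepFun Y Z Pr) :
    IndepFun (fun ω => (X ω, Y ω)) Z Pr := by
  have hXY : IndepFun X Y Pr := h.comp measurable_id measurable_fst
  rw [indepFun_iff_map_prod_eq_prod_map_map (by fun_prop) (by fun_prop)] at h h' hXY ⊢
  have := Measure.isProbabilityMeasure_map hX.aemeasurable (μ := Pr)
  have := Measure.isProbabilityMeasure_map hY.aemeasurable (μ := Pr)
  have := Measure.isProbabilityMeasure_map hZ.aemeasurable (μ := Pr)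
  rw [hXY]
  rw [h', ← Measure.prodAssoc_prod] at h
  have e : (fun ω => ((X ω, Y ω), Z ω)) =
      MeasurableEquiv.prodAssoc.symm ∘ fun ω => (X ω, (Y ω, Z ω)) := rfl
  rw [e, ← Measure.map_map (by fun_prop) (by fun_prop), h,
    Measure.map_map (by fun_prop) (by fun_prop)]
  simp

/-- If `W` is independent of `H`, then `φ a W` is distributed according to the conditional law of
`φ H W` given `H = a`. -/
lemma _root_.ProbabilityTheory.IndepFun.map_prodMk_eq_compProd {Ω α β γ : Type*}
    [MeasurableSpace Ω] [MeasurableSpace α] [MeasurableSpace β] [MeasurableSpace γ]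
    {Pr : Measure Ω} [IsProbabilityMeasure Pr] {H : Ω → α} {W : Ω → β} (h : IndepFun H W Pr)
    (hH : Measurable H) (hW : Measurable W) {φ : α → β → γ}
    (hφ : Measurable fun p : α × β => φ p.1 p.2) {κ : Kernel α γ} [IsSFiniteKernel κ]
    (hκ : ∀ a, (Pr.map W).map (φ a) = κ a) :
    Pr.map (fun ω => (H ω, φ (H ω) (W ω))) = Pr.map H ⊗ₘ κ := by
  have := Measure.isProbabilityMeasure_map hH.aemeasurable (μ := Pr)
  have := Measure.isProbabilityMeasure_map hW.aemeasurable (μ := Pr)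
  have hF : Measurable fun p : α × β => (p.1, φ p.1 p.2) := measurable_fst.prodMk hφ
  have e : (fun ω => (H ω, φ (H ω) (W ω))) =
      (fun p : α × β => (p.1, φ p.1 p.2)) ∘ fun ω => (H ω, W ω) := rfl
  rw [e, ← Measure.map_map hF (hH.prodMk hW),
    (indepFun_iff_map_prod_eq_prod_map_map hH.aemeasurable hW.aemeasurable).1 h]
  ext s hs
  rw [Measure.map_apply hF hs, Measure.prod_apply (hF hs), Measure.compProd_apply hs]
  refine lintegral_congr fun a => ?_
  have hφa : Measurable (φ a) := hφ.comp measurable_prodMk_left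
  rw [← hκ a, Measure.map_apply hφa (measurable_prodMk_left hs)]
  rfl

/-- One step of the system from `z` with noise vectors `v`. -/
noncomputable def stepMap (z : EuclideanSpace ℝ (Fin n)) (v : Fin M → EuclideanSpace ℝ (Fin n)) :
    EuclideanSpace ℝ (Fin n) :=
  ∑ j, (S.region j).indicator (fun z => S.lin j z + v j) z

lemma measurable_stepMap : Measurable fun p : EuclideanSpace ℝ (Fin n) ×
    (Fin M → EuclideanSpace ℝ (Fin n)) => S.stepMap p.1 p.2 := by
  unfold stepMap
  refine Finset.measurable_sum _ fun j _ => ?_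
  have h : (fun p : EuclideanSpace ℝ (Fin n) × (Fin M → EuclideanSpace ℝ (Fin n)) =>
      (S.region j).indicator (fun z => S.lin j z + p.2 j) p.1) =
      (Prod.fst ⁻¹' S.region j).indicator fun p : EuclideanSpace ℝ (Fin n) ×
        (Fin M → EuclideanSpace ℝ (Fin n)) => S.lin j p.1 + p.2 j := by
    ext1 p
    by_cases hp : p.1 ∈ S.region j <;> simp [Set.indicator, hp]
  rw [h]
  exact Measurable.indicator (by fun_prop) (measurable_fst (S.measurableSet_region j))

/-- The state after `t` steps as a function of the initial state and of the noise path. -/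
noncomputable def stateMap : ℕ → EuclideanSpace ℝ (Fin n) →
    (ℕ → Fin M → EuclideanSpace ℝ (Fin n)) → EuclideanSpace ℝ (Fin n)
  | 0, z, _ => z
  | t + 1, z, v => S.stepMap (stateMap t z v) (v t)

lemma measurable_stateMap (t : ℕ) : Measurable fun p : EuclideanSpace ℝ (Fin n) ×
    (ℕ → Fin M → EuclideanSpace ℝ (Fin n)) => S.stateMap t p.1 p.2 := by
  induction t with
  | zero => exact measurable_fst
  | succ t ih =>
    exact S.measurable_stepMap.comp
      (ih.prodMk ((measurable_pi_apply t).comp measurable_snd))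

lemma stateMap_congr {v v' : ℕ → Fin M → EuclideanSpace ℝ (Fin n)} {t : ℕ}
    (h : ∀ s < t, v s = v' s) (z : EuclideanSpace ℝ (Fin n)) :
    S.stateMap t z v = S.stateMap t z v' := by
  induction t with
  | zero => rfl
  | succ t ih =>
    rw [stateMap, stateMap, ih fun s hs => h s (by omega), h t (by omega)]

variable {S} {Ω : Type*} [MeasurableSpace Ω] {Pr : Measure Ω}
  {w : ℕ → Fin M → Ω → EuclideanSpace ℝ (Fin n)} {x : ℕ → Ω → EuclideanSpace ℝ (Fin n)}

lemma IsTrajectory.eq_stateMap (h : S.IsTrajectory Pr w x) (t : ℕ) (ω : Ω) :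
    x t ω = S.stateMap t (x 0 ω) fun s j => w s j ω := by
  induction t with
  | zero => rfl
  | succ t ih => rw [h.step, ih]; rfl

lemma IsTrajectory.measurable_state (h : S.IsTrajectory Pr w x) (t : ℕ) : Measurable (x t) := by
  have e : x t = fun ω => S.stateMap t (x 0 ω) fun s j => w s j ω := funext (h.eq_stateMap t)
  have h0 := h.measurable_init
  have hw : Measurable fun ω (s : ℕ) (j : Fin M) => w s j ω :=
    measurable_pi_iff.2 fun s => measurable_pi_iff.2 fun j => h.measurable_noise s j
  rw [e]
  exact (S.measurable_stateMap t).comp (h0.prodMk hw)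

/-- The states up to time `t` are functions of the initial state and of the noise before time `t`,
hence independent of the noise at time `t`. -/
lemma IsTrajectory.indepFun_history [IsProbabilityMeasure Pr] (h : S.IsTrajectory Pr w x) (t : ℕ) :
    IndepFun (fun ω (i : Fin (t + 1)) => x i ω) (fun ω j => w t j ω) Pr := by
  have hw : ∀ s, Measurable fun ω (j : Fin M) => w s j ω := fun s =>
    measurable_pi_iff.2 fun j => h.measurable_noise s j
  let past : Ω → (Finset.range t → Fin M → EuclideanSpace ℝ (Fin n)) := fun ω s j => w s j ω
  have hpast : Measurable past := measurable_pi_iff.2 fun s => hw s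
  have h1 : IndepFun past (fun ω j => w t j ω) Pr :=
    (h.indep_time.indepFun_finset (Finset.range t) {t} (by simp) hw).comp measurable_id
      (measurable_pi_apply (⟨t, Finset.mem_singleton_self t⟩ : ({t} : Finset ℕ)))
  have h2 : IndepFun (x 0) (fun ω => (past ω, fun j => w t j ω)) Pr := by
    refine h.indep_init.comp (φ := id) (ψ := fun v => (fun s : Finset.range t => v s, v t))
      measurable_id ?_
    fun_prop
  have h3 := IndepFun.prodMk_left_of_prodMk_right h.measurable_init hpast (hw t) h2 h1
  -- the noise from time `t` on does not enter the states up to time `t` and is replaced by `0`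
  let ext : (Finset.range t → Fin M → EuclideanSpace ℝ (Fin n)) →
      ℕ → Fin M → EuclideanSpace ℝ (Fin n) :=
    fun v s => if hs : s ∈ Finset.range t then v ⟨s, hs⟩ else 0
  have hext : Measurable ext := by
    refine measurable_pi_iff.2 fun s => ?_
    by_cases hs : s ∈ Finset.range t
    · simp only [ext, hs, dite_true]; fun_prop
    · simp only [ext, hs, dite_false]; fun_prop
  have e : (fun ω (i : Fin (t + 1)) => x i ω) =
      (fun p (i : Fin (t + 1)) => S.stateMap i p.1 (ext p.2)) ∘ fun ω => (x 0 ω, past ω) := by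
    ext1 ω
    ext1 i
    rw [h.eq_stateMap]
    refine S.stateMap_congr (fun s hs => ?_) _
    have hs' : s ∈ Finset.range t := Finset.mem_range.2 (by omega)
    simp only [ext, hs', dite_true, past]
  rw [e]
  refine h3.comp (measurable_pi_iff.2 fun i => ?_) measurable_id
  exact (S.measurable_stateMap i).comp (measurable_fst.prodMk (hext.comp measurable_snd))

lemma IsTrajectory.map_stepMap (h : S.IsTrajectory Pr w x) (t : ℕ)
    (z : EuclideanSpace ℝ (Fin n)) :
    (Pr.map fun ω j => w t j ω).map (S.stepMap z) = S.transition z := by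
  obtain ⟨j, hj⟩ := S.exists_mem_region z
  have hw : Measurable fun ω (j : Fin M) => w t j ω :=
    measurable_pi_iff.2 fun j => h.measurable_noise t j
  have e : S.stepMap z = fun v => S.lin j z + v j :=
    funext fun v => S.sum_indicator_region (fun j z => S.lin j z + v j) hj
  rw [S.transition_apply_of_mem hj, multivariateGaussian_one_eq_map_add, ← h.law_noise t j, e,
    Measure.map_map (by fun_prop) hw, Measure.map_map (by fun_prop) (h.measurable_noise t j)]
  rfl

theorem IsTrajectory.isMarkovChain [IsProbabilityMeasure Pr] (h : S.IsTrajectory Pr w x) :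
    IsMarkovChain S.transition Pr x := by
  intro t
  have hH : Measurable fun ω (i : Fin (t + 1)) => x i ω :=
    measurable_pi_iff.2 fun i => h.measurable_state i
  have hw : Measurable fun ω (j : Fin M) => w t j ω :=
    measurable_pi_iff.2 fun j => h.measurable_noise t j
  have hφ : Measurable fun p : (Fin (t + 1) → EuclideanSpace ℝ (Fin n)) ×
      (Fin M → EuclideanSpace ℝ (Fin n)) => S.stepMap (p.1 (Fin.last t)) p.2 := by
    have hlast : Measurable fun p : (Fin (t + 1) → EuclideanSpace ℝ (Fin n)) ×
        (Fin M → EuclideanSpace ℝ (Fin n)) => (p.1 (Fin.last t), p.2) := by fun_prop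
    exact S.measurable_stepMap.comp hlast
  have e : x (t + 1) = fun ω => S.stepMap (x t ω) fun j => w t j ω :=
    funext (h.step t)
  rw [e]
  exact (h.indepFun_history t).map_prodMk_eq_compProd hH hw
    (φ := fun y v => S.stepMap (y (Fin.last t)) v) hφ
    fun y => h.map_stepMap t (y (Fin.last t))

end SLDS

theorem lemma4 {n M : ℕ} (S : SLDS n M) (ϱ L γ : ℝ)
    (h_bdd : ∀ k : Fin M, S.region k ⊂ Metric.closedBall 0 ϱ → ‖S.lin k‖ ≤ L)
    (h_compl : ∀ j : Fin M, ¬ S.region j ⊂ Metric.closedBall 0 ϱ → ‖S.lin j‖ ≤ γ)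
    (hγ : γ < 1) :
    -- the system is a Markov chain with transition kernel `P = S.transition`
    (∀ (Ω : Type*) [MeasurableSpace Ω] (Pr : Measure Ω) [IsProbabilityMeasure Pr]
      (w : ℕ → Fin M → Ω → EuclideanSpace ℝ (Fin n)) (x : ℕ → Ω → EuclideanSpace ℝ (Fin n)),
      S.IsTrajectory Pr w x → IsMarkovChain S.transition Pr x) ∧
    -- drift and minorization
    GeometricDrift S.transition (fun x => ‖x‖) γ (√((n : ℝ) + L ^ 2 * ϱ ^ 2)) ∧
    (∃ R : ℝ, 2 * √((n : ℝ) + L ^ 2 * ϱ ^ 2) / (1 - γ) < R ∧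
      Minorization S.transition (fun x => ‖x‖) R) ∧
    -- a unique invariant distribution, which is ergodic, and geometric mixing towards it
    ∃ μ : Measure (EuclideanSpace ℝ (Fin n)),
      IsErgodicInvariant S.transition μ ∧
      (∀ ν : Measure (EuclideanSpace ℝ (Fin n)),
        IsProbabilityMeasure ν → S.transition.Invariant ν → ν = μ) ∧
      ∃ β : ℝ, 0 < β ∧ ∃ κ : ℝ, 0 < κ ∧ κ < 1 ∧
        (∀ x y : EuclideanSpace ℝ (Fin n),
          wasserstein (weightedDist β fun z => ‖z‖) (S.transition x) (S.transition y) ≤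
            ENNReal.ofReal (κ * weightedDist β (fun z => ‖z‖) x y)) ∧
        (∀ x : EuclideanSpace ℝ (Fin n),
          wasserstein (weightedDist β fun z => ‖z‖) (S.transition x) μ < ∞) ∧
        ∃ C : ℝ, 0 < C ∧ ∀ (x : EuclideanSpace ℝ (Fin n)) (m : ℕ), 1 ≤ m →
          wasserstein (weightedDist β fun z => ‖z‖) ((S.transition ^ m) x) μ ≤
            ENNReal.ofReal (C * κ ^ m) *
              wasserstein (weightedDist β fun z => ‖z‖) (S.transition x) μ := by
  have hdrift := S.geometricDrift_transition h_bdd h_compl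
  have hR : 2 * √((n : ℝ) + L ^ 2 * ϱ ^ 2) / (1 - γ) <
      2 * √((n : ℝ) + L ^ 2 * ϱ ^ 2) / (1 - γ) + 1 := lt_add_one _
  have hmin := S.minorization_transition (2 * √((n : ℝ) + L ^ 2 * ϱ ^ 2) / (1 - γ) + 1)
  exact ⟨fun Ω _ Pr _ w x h => h.isMarkovChain, hdrift, ⟨_, hR, hmin⟩,
    harris measurable_norm norm_nonneg hγ (Real.sqrt_nonneg _) hR hdrift hmin⟩
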